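/- Let $k,n$ be integers with $1<k\le n\le 2k-1$, let $q$ be a prime with $q>n+k-1$, and let $m=\operatorname{lcm}\{1,2,\dots,n-k+1\}$. Definitions. All qudits have dimension $q$. A $((k,n))$ quantum threshold scheme for a secret of $m$ qudits is a quantum operation (completely positive trace-preserving map) from the secret to the shares of $n$ parties such that any $k$ or more parties can recover every secret state by a quantum operation, and the joint state of the shares of any $k-1$ or fewer parties does not depend on the secret state. Its share size $w_j$ is the number of qudits given to party $j$. Suppose that for every set $D$ of at least $k$ parties it is fixed which qudits of their shares the parties in $D$ send to a combiner, and that a quantum operation on these qudits recovers the secret. $\mathrm{CC}_n(d)$ is the maximal number of qudits sent, over all sets $D$ of $d$ parties. The scheme is a $((k,n,*))$ universal communication efficient quantum threshold scheme if $\mathrm{CC}_n(d')<\mathrm{CC}_n(d)$ whenever $k\le d<d'\le n$. Ramp encoder (Ogawa et al.). For $z<t$ and distinct non-zero $x_1,\dots,x_{t+z}\in\mathbb F_q$ it maps $|s_1\cdots s_{t-z}\rangle$ to $$q^{-z/2}\sum_{r\in\mathbb F_q^z}|u_1(s,r)\rangle\cdots|u_{t+z}(s,r)\rangle,\qquad u_j(s,r)=\sum_{a=1}^{t-z}s_a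 x_j^{a-1}+\sum_{b=1}^{z}r_b x_j^{t-z+b-1}.$$ An input of $N(t-z)$ qudits is divided into $N$ blocks of $t-z$ qudits which are encoded separately; each share then consists of $N$ qudits. Concatenated encoding. For $1\le i\le n-k+1$ put $d_i=n+1-i$, and let layer $i$ be a ramp encoder with $t=d_i$, $z=k-1$. Its $d_i+k-1$ shares are used as follows: the first $n$ are given to the parties $1,\dots,n$; for $1\le\ell\le d_i-k$ the share number $n+\ell$ becomes part of the input of layer $i+\ell$; the remaining $2k-1-n$ shares are discarded. The input of layer $1$ is the secret of $m$ qudits. When a set $D$ of $d_i$ parties is accessed, each party in $D$ sends to the combiner its qudits from layers $1,\dots,i$. Claim. The construction can be carried out: in every layer there are distinct non-zero evaluation points in $\mathbb F_q$, and the number of input qudits is divisible by $d_i-k+1$. For every choice of the evaluation points (which may differ between layers) and of the division of the inputs into blocks, the concatenated encoding with the stated choice of the qudits sent is a $((k,n,*))$ universal communication efficient quantum threshold scheme for a secret of $m$ qudits of dimension $q$, with $$w_1=\dots=w_n=m,\qquad \mathrm{CC}_n(d)=\frac{dm}{d-k+1}\quad\text{for all } d\in\{k,k+1,\dots,n\}.$$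 -/

import Mathlib

open scoped Matrix ComplexOrder

namespace QSS

noncomputable section

/-! ### Finite-dimensional quantum systems

A register of `q`-dimensional qudits labelled by `Q` has standard basis `Q → ZMod q`; operators on
it are matrices indexed by that basis. -/

/-- Density matrices. -/
def IsDensity {α : Type} [Fintype α] (ρ : Matrix α α ℂ) : Prop :=
  ρ.PosSemidef ∧ ρ.trace = 1

/-- Quantum operations (completely positive trace preserving maps), in Kraus form. -/
def IsQuantumChannel {α β : Type} [Fintype α] [DecidableEq α] [Fintype β]
    (Φ : Matrix α α ℂ → Matrix β β ℂ) : Prop :=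
  ∃ (N : ℕ) (K : Fin N → Matrix β α ℂ),
    (∑ i, (K i)ᴴ * K i = 1) ∧ ∀ X, Φ X = ∑ i, K i * X * (K i)ᴴ

/-- Partial trace over the second tensor factor. -/
def traceOutRight {α β : Type} [Fintype β] (X : Matrix (α × β) (α × β) ℂ) : Matrix α α ℂ :=
  fun a a' => ∑ b, X (a, b) (a', b)

/-- The state of the qudits in `A`: all the other qudits are traced out. -/
def reducedState {q : ℕ} [NeZero q] {Q : Type} [Fintype Q] [DecidableEq Q] (A : Finset Q)
    (X : Matrix (Q → ZMod q) (Q → ZMod q) ℂ) :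
    Matrix ({w // w ∈ A} → ZMod q) ({w // w ∈ A} → ZMod q) ℂ :=
  traceOutRight (X.submatrix
    (Equiv.piEquivPiSubtypeProd (fun w => w ∈ A) (fun _ => ZMod q)).symm
    (Equiv.piEquivPiSubtypeProd (fun w => w ∈ A) (fun _ => ZMod q)).symm)

/-! ### Quantum secret sharing schemes -/

/-- The data of a quantum secret sharing scheme for `n` parties and a secret of `m` qudits:
`Q` labels all qudits distributed to the parties, `owner` says which party gets a qudit, `encode`
is the encoding, and `sent D` is the set of qudits that the parties in `D` send to the combiner
when the combiner accesses exactly the parties in `D`. -/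
structure Scheme (q m n : ℕ) (Q : Type) where
  owner : Q → Fin n
  encode : Matrix (Fin m → ZMod q) (Fin m → ZMod q) ℂ → Matrix (Q → ZMod q) (Q → ZMod q) ℂ
  sent : Finset (Fin n) → Finset Q

namespace Scheme

variable {q m n : ℕ} [NeZero q] {Q : Type} [Fintype Q] [DecidableEq Q]

/-- All qudits held by the parties in `A`. -/
def shares (S : Scheme q m n Q) (A : Finset (Fin n)) : Finset Q :=
  Finset.univ.filter fun w => S.owner w ∈ A

/-- The size `w_j` of the share of party `j`, in qudits. -/
def shareSize (S : Scheme q m n Q) (j : Fin n) : ℕ := (S.shares {j}).card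

/-- Some quantum operation on the qudits in `A` restores every secret state. -/
def Recovers (S : Scheme q m n Q) (A : Finset Q) : Prop :=
  ∃ R : Matrix ({w // w ∈ A} → ZMod q) ({w // w ∈ A} → ZMod q) ℂ →
      Matrix (Fin m → ZMod q) (Fin m → ZMod q) ℂ,
    IsQuantumChannel R ∧ ∀ ρ, IsDensity ρ → R (reducedState A (S.encode ρ)) = ρ

/-- The state of the qudits in `A` does not depend on the secret state. -/
def NoInformation (S : Scheme q m n Q) (A : Finset Q) : Prop :=
  ∀ ρ ρ', IsDensity ρ → IsDensity ρ' →
    reducedState A (S.encode ρ) = reducedState A (S.encode ρ')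

/-- `((k,n))` quantum threshold secret sharing schemes. -/
def IsQTS (S : Scheme q m n Q) (k : ℕ) : Prop :=
  1 < k ∧ k ≤ n ∧ n ≤ 2 * k - 1 ∧ IsQuantumChannel S.encode ∧
    (∀ A : Finset (Fin n), k ≤ A.card → S.Recovers (S.shares A)) ∧
    ∀ B : Finset (Fin n), B.card < k → S.NoInformation (S.shares B)

/-- `CC_n(d)`: the maximal number of qudits sent to the combiner over all sets of `d` parties. -/
def commCost (S : Scheme q m n Q) (d : ℕ) : ℕ :=
  ((Finset.univ : Finset (Fin n)).powersetCard d).sup fun D => (S.sent D).card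

/-- `((k,n,*))` universal communication efficient quantum threshold schemes: a threshold scheme in
which every authorized set `D` sends only qudits of its own shares, what it sends suffices to
recover the secret, and the communication cost strictly decreases with the number of parties. -/
def IsUniversalCEQTS (S : Scheme q m n Q) (k : ℕ) : Prop :=
  S.IsQTS k ∧
    (∀ D : Finset (Fin n), k ≤ D.card → S.sent D ⊆ S.shares D ∧ S.Recovers (S.sent D)) ∧
    ∀ d d' : ℕ, k ≤ d → d < d' → d' ≤ n → S.commCost d' < S.commCost d

end Scheme

/-! ### The ramp schemes of Ogawa et al. -/

/-- The value `u_j(s, r) = s_1 + s_2 x_j + ⋯ + s_μ x_j^(μ-1) + r_1 x_j^μ + ⋯ + r_z x_j^(μ+z-1)`. -/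
def rampValue {q : ℕ} {J : Type} (x : J → ZMod q) {μ z : ℕ} (s : Fin μ → ZMod q)
    (r : Fin z → ZMod q) (j : J) : ZMod q :=
  (∑ a : Fin μ, s a * x j ^ (a : ℕ)) + ∑ b : Fin z, r b * x j ^ (μ + (b : ℕ))

/-- The matrix of the ramp encoder `|s⟩ ↦ q^(-z/2) ∑_r ⊗_j |u_j(s, r)⟩` with evaluation points
`x`, for a secret of `μ` qudits and one-qudit shares labelled by `J`. -/
def rampEncoder {q : ℕ} [NeZero q] {J : Type} [Fintype J] (x : J → ZMod q) (μ z : ℕ) :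
    Matrix (J → ZMod q) (Fin μ → ZMod q) ℂ :=
  fun y s => ∑ r : Fin z → ZMod q,
    if y = rampValue x s r then (((Real.sqrt ((q : ℝ) ^ z))⁻¹ : ℝ) : ℂ) else 0

/-- The ramp encoder applied separately to each of `N` blocks of `μ` qudits; every share now
consists of `N` qudits. -/
def blockRampEncoder {q : ℕ} [NeZero q] {J : Type} [Fintype J] (x : J → ZMod q) (N μ z : ℕ) :
    Matrix (J × Fin N → ZMod q) (Fin N × Fin μ → ZMod q) ℂ :=
  fun y s => ∏ c : Fin N, rampEncoder x μ z (fun j => y (j, c)) (fun a => s (c, a))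

/-! ### The concatenated scheme

The layers `1, …, n-k+1` are numbered here by `i : Fin (n - k + 1)`, starting from `0`, so that
layer `i` uses a `((d, n+d-k; k-1))` ramp scheme with `d = n - i`. It encodes blocks of
`d - (k-1) = n - k + 1 - i` qudits and is obtained from a scheme with `d + k - 1` shares. -/

/-- Labels of the `d + k - 1` shares of the ramp scheme of layer `i`: `n` shares for the parties,
`d - k` shares to be encoded again in later layers, and `2k-1-n` shares that are discarded. -/
abbrev RampShare (k n : ℕ) (i : Fin (n - k + 1)) : Type :=
  Fin n ⊕ (Fin (n - k - i) ⊕ Fin (2 * k - 1 - n))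

/-- The size in qudits of each share of the ramp scheme of layer `i`: the size of the input of that
layer, divided by `d - (k-1)`. The input of the first layer is the secret of `m` qudits; the input
of a later layer consists of one share from every earlier layer. -/
def layerShareSize (k n m : ℕ) (i : ℕ) : ℕ :=
  (if i = 0 then m else ∑ l : Fin i, layerShareSize k n m l) / (n - k + 1 - i)
termination_by i
decreasing_by exact l.isLt

/-- Qudits given to the parties: layer, party, position within the share. -/
abbrev PartyQudit (k n m : ℕ) : Type :=
  Σ i : Fin (n - k + 1), Fin n × Fin (layerShareSize k n m i)

/-- Qudits that are encoded again: layer, number of the extra share, position in the share. -/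
abbrev ForwardQudit (k n m : ℕ) : Type :=
  Σ i : Fin (n - k + 1), Fin (n - k - i) × Fin (layerShareSize k n m i)

/-- Discarded qudits: layer, number of the discarded share, position within the share. -/
abbrev DiscardedQudit (k n m : ℕ) : Type :=
  Σ i : Fin (n - k + 1), Fin (2 * k - 1 - n) × Fin (layerShareSize k n m i)

/-- The layer by which a qudit is encoded: layer `0` for the qudits of the secret; the `l`-th extra
share (`l = 1, 2, …`, numbered from `0` in Lean) of layer `i` goes to layer `i + l`. -/
def targetLayer {k n m : ℕ} : Fin m ⊕ ForwardQudit k n m → ℕ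
  | Sum.inl _ => 0
  | Sum.inr w => (w.1 : ℕ) + (w.2.1 : ℕ) + 1

/-- The input qudits of layer `i`. -/
abbrev LayerInput (k n m : ℕ) (i : Fin (n - k + 1)) : Type :=
  {w : Fin m ⊕ ForwardQudit k n m // targetLayer w = (i : ℕ)}

/-- The free choices in the construction: in every layer, distinct non-zero evaluation points for
the ramp scheme, and a division of the input qudits into blocks of `d - (k-1)` qudits. -/
structure Choices (q k n m : ℕ) where
  point : (i : Fin (n - k + 1)) → RampShare k n i → ZMod q
  point_injective : ∀ i, Function.Injective (point i)
  point_ne_zero : ∀ i j, point i j ≠ 0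
  grouping : (i : Fin (n - k + 1)) →
    LayerInput k n m i ≃ Fin (layerShareSize k n m i) × Fin (n - k + 1 - i)

variable {q k n m : ℕ} [NeZero q]

/-- The basis label of the output of layer `i`, read off from the labels of all qudits. -/
def layerOutput (y : PartyQudit k n m → ZMod q) (f : ForwardQudit k n m → ZMod q)
    (e : DiscardedQudit k n m → ZMod q) (i : Fin (n - k + 1)) :
    RampShare k n i × Fin (layerShareSize k n m i) → ZMod q
  | (Sum.inl j, c) => y ⟨i, j, c⟩
  | (Sum.inr (Sum.inl l), c) => f ⟨i, l, c⟩
  | (Sum.inr (Sum.inr j), c) => e ⟨i, j, c⟩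

/-- The basis label of the input of layer `i`, arranged in blocks. -/
def layerInput (P : Choices q k n m) (s : Fin m → ZMod q) (f : ForwardQudit k n m → ZMod q)
    (i : Fin (n - k + 1)) :
    Fin (layerShareSize k n m i) × Fin (n - k + 1 - i) → ZMod q :=
  fun p => Sum.elim s f ((P.grouping i).symm p).1

/-- The matrix of the composite of all layers, from the secret to the qudits of the parties and the
discarded qudits. Layer `i` acts by its ramp encoder on its own input qudits and by the identity on
all others. The matrix product of the layers is written out: the sum runs over the basis
labels `f` of the qudits passed from a layer to a later one. -/
def concatMatrix (P : Choices q k n m) :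
    Matrix ((PartyQudit k n m → ZMod q) × (DiscardedQudit k n m → ZMod q)) (Fin m → ZMod q) ℂ :=
  fun ye s => ∑ f : ForwardQudit k n m → ZMod q, ∏ i : Fin (n - k + 1),
    blockRampEncoder (P.point i) (layerShareSize k n m i) (n - k + 1 - i) (k - 1)
      (layerOutput ye.1 f ye.2 i) (layerInput P s f i)

/-- The concatenated scheme. When the combiner accesses a set `D` of `d` parties, each of them
sends its qudits from the first `n - d + 1` layers. -/
def concatScheme (P : Choices q k n m) : Scheme q m n (PartyQudit k n m) where
  owner w := w.2.1
  encode ρ := traceOutRight (concatMatrix P * ρ * (concatMatrix P)ᴴ)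
  sent D := Finset.univ.filter fun w => w.2.1 ∈ D ∧ (w.1 : ℕ) < n - D.card + 1

end

end QSS

namespace QSS

/-! Each ramp encoder sends a basis state to a uniform superposition over an affine subspace, so
everything reduces to linear algebra over `ZMod q`. The column of `concatMatrix` at `s` is a
constant on the labels reachable from `s` and zero elsewhere (`concatMatrix_eq_ite`), and it is the
translate of column `0` by any label reachable from `s` (`Consistent.concatMatrix_eq`).

Suppose a register `A` satisfies: (a) the label on `A` determines `s`; (b) every `s` reaches some
label vanishing outside `A`. Translating back on `A`, controlled on `s`, leaves the secret in
product with a fixed state, so `A` recovers the secret (`exists_recovery`). Tracing out `A` destroys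
all coherences and leaves a state independent of `s`, so the rest learns nothing
(`traceOutRight_conj_eq_of_trace_eq`). Secrecy for fewer than `k` parties comes from taking as `A`
everything else, discarded qudits included.

Both conditions are share counts, with layers numbered from `0` and `n - i₀` parties sending layers
up to `i₀`. For (a), decode from layer `i₀` downwards: layer `i` needs `n - i` shares, and to the `n
- i₀` at hand come the `i₀ - i` forwarded to layers already decoded (`Consistent.eq_zero`). For (b),
at most `k - 1` shares of layer `i` remain, and its `k - 1` random symbols can make them vanish
(`exists_consistent_eq_zero`).

The costs follow from the cumulative share size `m / (n - k + 1 - i)` of layers `0, …, i`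
(`sum_layerShareSize`). -/

theorem isQuantumChannel_of_kraus {α β ι : Type} [Fintype α] [DecidableEq α] [Fintype β]
    [Fintype ι] {Φ : Matrix α α ℂ → Matrix β β ℂ} (K : ι → Matrix β α ℂ)
    (hK : ∑ i, (K i)ᴴ * K i = 1) (hΦ : ∀ X, Φ X = ∑ i, K i * X * (K i)ᴴ) :
    IsQuantumChannel Φ := by
  let e := (Fintype.equivFin ι).symm
  refine ⟨Fintype.card ι, fun i => K (e i), ?_, fun X => ?_⟩
  · rw [← hK]; exact e.sum_comp fun i => (K i)ᴴ * K i
  · rw [hΦ]; exact (e.sum_comp fun i => K i * X * (K i)ᴴ).symm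

/-! ### Recovery and secrecy for isometries with translated columns -/

section Isometry

variable {α β σ : Type} [Fintype β]

/-- The rows of `M` whose label has second component `b`. -/
def rowSlice (M : Matrix (α × β) σ ℂ) (b : β) : Matrix α σ ℂ := fun a s => M (a, b) s

theorem traceOutRight_conj [Fintype σ] (M : Matrix (α × β) σ ℂ) (ρ : Matrix σ σ ℂ) :
    traceOutRight (M * ρ * Mᴴ) = ∑ b, rowSlice M b * ρ * (rowSlice M b)ᴴ := by
  ext a a'
  simp [traceOutRight, rowSlice, Matrix.sum_apply, Matrix.mul_apply]

theorem sum_rowSlice [Fintype α] (M : Matrix (α × β) σ ℂ) :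
    ∑ b, (rowSlice M b)ᴴ * rowSlice M b = Mᴴ * M := by
  ext s s'
  simp only [Matrix.sum_apply, Matrix.mul_apply, rowSlice, Matrix.conjTranspose_apply]
  rw [Fintype.sum_prod_type, Finset.sum_comm]

theorem isQuantumChannel_traceOutRight_conj [Fintype α] [Fintype σ] [DecidableEq σ]
    (M : Matrix (α × β) σ ℂ) (hM : Mᴴ * M = 1) :
    IsQuantumChannel fun ρ : Matrix σ σ ℂ => traceOutRight (M * ρ * Mᴴ) :=
  isQuantumChannel_of_kraus (rowSlice M) (by rw [sum_rowSlice, hM]) (traceOutRight_conj M)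

/-- An isometry whose output on `α` determines the input label, and whose columns are all
translates of one column along `α`, can be inverted on `α`. -/
theorem exists_recovery [Fintype α] [DecidableEq α] [AddGroup α] [Fintype σ] [DecidableEq σ]
    (M : Matrix (α × β) σ ℂ) (hM : Mᴴ * M = 1)
    (hsep : ∀ a b b' s s', M (a, b) s ≠ 0 → M (a, b') s' ≠ 0 → s = s')
    (s₀ : σ) (g : σ → α) (hg : ∀ a b s, M (a, b) s = M (a - g s, b) s₀) :
    ∃ R : Matrix α α ℂ → Matrix σ σ ℂ, IsQuantumChannel R ∧
      ∀ ρ, R (traceOutRight (M * ρ * Mᴴ)) = ρ := by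
  classical
  obtain ⟨D, hD⟩ : ∃ D : α → σ, ∀ a b s, M (a, b) s ≠ 0 → D a = s := by
    refine ⟨fun a => if h : ∃ s b, M (a, b) s ≠ 0 then h.choose else s₀, fun a b s h => ?_⟩
    have h' : ∃ s b, M (a, b) s ≠ 0 := ⟨s, b, h⟩
    simp only [dif_pos h']
    obtain ⟨b', hb'⟩ := h'.choose_spec
    exact hsep _ _ _ _ _ hb' h
  -- `K b` reads off `s = D a`, subtracts `g s` and projects the remainder onto `b`. Each `a`
  -- belongs to exactly one pair `(b, s)`, even where `D` takes its default value `s₀`, so the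
  -- operation is trace preserving.
  obtain ⟨K, hKa⟩ : ∃ K : α → Matrix σ α ℂ,
      ∀ b s a, K b s a = if D a = s ∧ a = b + g s then 1 else 0 :=
    ⟨fun b => Matrix.of fun s a => if D a = s ∧ a = b + g s then 1 else 0, fun _ _ _ => rfl⟩
  have hK : ∑ b, (K b)ᴴ * K b = 1 := by
    ext a a'
    simp only [hKa, Matrix.sum_apply, Matrix.mul_apply, Matrix.conjTranspose_apply, apply_ite star,
      star_one, star_zero, ite_mul, one_mul, zero_mul, ← ite_and]
    rw [Matrix.one_apply, Finset.sum_eq_single (a - g (D a)), Finset.sum_eq_single (D a)]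
    · by_cases h : a = a'
      · subst h; simp
      · rw [if_neg, if_neg h]
        rintro ⟨⟨-, h₁⟩, -, h₂⟩
        exact h (h₁.trans h₂.symm)
    · intro s _ hs
      exact if_neg fun h => hs h.1.1.symm
    · simp
    · intro b _ hb
      refine Finset.sum_eq_zero fun s _ => if_neg fun h => hb ?_
      rw [h.1.1]; exact eq_sub_of_add_eq h.1.2.symm
    · simp
  have hKM : ∀ b' b, K b' * rowSlice M b = M (b', b) s₀ • (1 : Matrix σ σ ℂ) := by
    intro b' b
    ext s' s
    simp only [hKa, rowSlice, Matrix.mul_apply, ite_mul, one_mul, zero_mul, Matrix.smul_apply,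
      smul_eq_mul, Matrix.one_apply]
    rw [Finset.sum_eq_single (b' + g s')]
    · by_cases hs : s' = s
      · subst hs
        have h₁ : M (b' + g s', b) s' = M (b', b) s₀ := by rw [hg]; simp
        by_cases h : D (b' + g s') = s'
        · simp [h, h₁]
        · have : M (b' + g s', b) s' = 0 := by
            by_contra h0
            exact h (hD _ _ _ h0)
          simp [h, ← h₁, this]
      · by_cases h0 : M (b' + g s', b) s = 0
        · simp [h0, hs]
        · rw [if_neg]
          · simp [hs]
          · rw [hD _ _ _ h0]
            exact fun h => hs h.1.symm
    · intro a _ ha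
      exact if_neg fun h => ha h.2
    · simp
  refine ⟨fun X => ∑ b, K b * X * (K b)ᴴ, isQuantumChannel_of_kraus K hK fun _ => rfl,
    fun ρ => ?_⟩
  -- Normalization of column `s₀`, obtained from trace preservation of `K` and the isometry `M`.
  have key : ∑ b', ∑ b, (M (b', b) s₀ * star (M (b', b) s₀)) • (1 : Matrix σ σ ℂ) = 1 := by
    calc _ = ∑ b', ∑ b, (K b' * rowSlice M b)ᴴ * (K b' * rowSlice M b) := by
            refine Finset.sum_congr rfl fun b' _ => Finset.sum_congr rfl fun b _ => ?_
            rw [hKM]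
            simp [smul_smul]
      _ = ∑ b, (rowSlice M b)ᴴ * (∑ b', (K b')ᴴ * K b') * rowSlice M b := by
            rw [Finset.sum_comm]
            refine Finset.sum_congr rfl fun b _ => ?_
            rw [Matrix.mul_sum, Matrix.sum_mul]
            refine Finset.sum_congr rfl fun b' _ => ?_
            simp only [Matrix.conjTranspose_mul, Matrix.mul_assoc]
      _ = 1 := by rw [hK]; simp only [Matrix.mul_one]; rw [sum_rowSlice, hM]
  calc ∑ b', K b' * traceOutRight (M * ρ * Mᴴ) * (K b')ᴴ
      = ∑ b', ∑ b, (K b' * rowSlice M b) * ρ * (K b' * rowSlice M b)ᴴ := by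
        rw [traceOutRight_conj]
        refine Finset.sum_congr rfl fun b' _ => ?_
        rw [Matrix.mul_sum, Matrix.sum_mul]
        refine Finset.sum_congr rfl fun b _ => ?_
        simp only [Matrix.conjTranspose_mul, Matrix.mul_assoc]
    _ = (∑ b', ∑ b, (M (b', b) s₀ * star (M (b', b) s₀)) • (1 : Matrix σ σ ℂ)) * ρ := by
        simp only [Finset.sum_mul]
        refine Finset.sum_congr rfl fun b' _ => Finset.sum_congr rfl fun b _ => ?_
        rw [hKM]
        simp [smul_smul, mul_comm]
    _ = ρ := by rw [key, Matrix.one_mul]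

/-- If the output on `β` determines the input label, and all columns of `M` are translates of one
column along `β`, then the output on `α` depends on the input only through its trace. -/
theorem traceOutRight_conj_eq_of_trace_eq [Fintype σ] [AddGroup β] (M : Matrix (α × β) σ ℂ)
    (hsep : ∀ a a' b s s', M (a, b) s ≠ 0 → M (a', b) s' ≠ 0 → s = s')
    (s₀ : σ) (g : σ → β) (hg : ∀ a b s, M (a, b) s = M (a, b - g s) s₀)
    {ρ ρ' : Matrix σ σ ℂ} (h : ρ.trace = ρ'.trace) :
    traceOutRight (M * ρ * Mᴴ) = traceOutRight (M * ρ' * Mᴴ) := by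
  classical
  have key : ∀ (τ : Matrix σ σ ℂ) a a', traceOutRight (M * τ * Mᴴ) a a' =
      τ.trace * ∑ b, M (a, b) s₀ * star (M (a', b) s₀) := by
    intro τ a a'
    have h₁ : ∀ b, (M * τ * Mᴴ) (a, b) (a', b) =
        ∑ s, τ s s * (M (a, b) s * star (M (a', b) s)) := by
      intro b
      simp only [Matrix.mul_apply, Matrix.conjTranspose_apply, Finset.sum_mul]
      refine Finset.sum_congr rfl fun s' _ => ?_
      -- Off-diagonal entries of `τ` drop out: both factors of `M` carry the same `b`, which fixes
      -- the secret.
      rw [Finset.sum_eq_single s']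
      · ring
      · intro s _ hs
        by_contra h0
        refine hs (hsep a a' b s s' (fun h => h0 (by simp [h])) fun h => h0 (by simp [h]))
      · simp
    simp only [traceOutRight, h₁]
    rw [Finset.sum_comm, Matrix.trace, Finset.sum_mul]
    refine Finset.sum_congr rfl fun s _ => ?_
    rw [← Finset.mul_sum, Matrix.diag_apply]
    congr 1
    rw [← Equiv.sum_comp (Equiv.subRight (g s)) fun b => M (a, b) s₀ * star (M (a', b) s₀)]
    exact Finset.sum_congr rfl fun b _ => by rw [hg a b s, hg a' b s]; rfl
  ext a a'
  rw [key, key, h]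

end Isometry

/-! ### Polynomial interpolation for one ramp encoder -/

section Ramp

variable {q : ℕ} {J : Type}

theorem rampValue_sub (x : J → ZMod q) {μ z : ℕ} (s s' : Fin μ → ZMod q) (r r' : Fin z → ZMod q)
    (j : J) : rampValue x (s - s') (r - r') j = rampValue x s r j - rampValue x s' r' j := by
  simp only [rampValue, Pi.sub_apply, sub_mul, Finset.sum_sub_distrib]
  ring

@[simp]
theorem rampValue_zero (x : J → ZMod q) {μ z : ℕ} (j : J) :
    rampValue x (0 : Fin μ → ZMod q) (0 : Fin z → ZMod q) j = 0 := by
  simp [rampValue]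

/-- Vandermonde: `s` and `r` together are the coefficients of a polynomial of degree below `μ + z`,
evaluated at distinct points. -/
theorem eq_zero_of_rampValue_eq_zero [Fact q.Prime] {x : J → ZMod q} (hx : Function.Injective x)
    {μ z : ℕ} {s : Fin μ → ZMod q} {r : Fin z → ZMod q} (Z : Finset J) (hZ : μ + z ≤ Z.card)
    (h : ∀ j ∈ Z, rampValue x s r j = 0) : s = 0 ∧ r = 0 := by
  obtain ⟨e⟩ : Nonempty (Fin (μ + z) ↪ Z) :=
    Function.Embedding.nonempty_of_card_le (by simpa using hZ)
  have hv : Fin.append s r = 0 :=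
    Matrix.eq_zero_of_forall_index_sum_mul_pow_eq_zero (f := fun i => x (e i))
      (hx.comp (Subtype.val_injective.comp e.injective)) fun i => by
        rw [Fin.sum_univ_add]
        simpa [rampValue] using h (e i) (e i).2
  constructor
  · ext a; simpa using congr_fun hv (Fin.castAdd z a)
  · ext b; simpa using congr_fun hv (Fin.natAdd μ b)

/-- The random part is `x ^ μ` times a polynomial with `z` free coefficients, so it can be
interpolated to cancel the secret part at `z` points. Dividing by `x ^ μ` is where non-zero points
are needed. -/
theorem exists_rampValue_eq_zero [Fact q.Prime] {x : J → ZMod q} (hx : Function.Injective x)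
    (hx0 : ∀ j, x j ≠ 0) {μ z : ℕ} (Z : Finset J) (hZ : Z.card ≤ z) (s : Fin μ → ZMod q) :
    ∃ r : Fin z → ZMod q, ∀ j ∈ Z, rampValue x s r j = 0 := by
  classical
  let p := Lagrange.interpolate Z x fun j => -(∑ a, s a * x j ^ (a : ℕ)) / x j ^ μ
  have hdeg : p.degree < Z.card := Lagrange.degree_interpolate_lt _ hx.injOn
  refine ⟨fun b => p.coeff b, fun j hj => ?_⟩
  have hev := Lagrange.eval_interpolate_at_node
    (fun j => -(∑ a, s a * x j ^ (a : ℕ)) / x j ^ μ) (hx.injOn (s := Z)) hj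
  have hsum : p.eval (x j) = ∑ b : Fin z, p.coeff b * x j ^ (b : ℕ) := by
    rw [Fin.sum_univ_eq_sum_range (fun b => p.coeff b * x j ^ b)]
    by_cases hp : p = 0
    · simp [hp]
    · refine Polynomial.eval_eq_sum_range' ?_ _
      have := (Polynomial.natDegree_lt_iff_degree_lt hp).2 hdeg
      omega
  have h₂ : ∑ b : Fin z, p.coeff b * x j ^ (μ + (b : ℕ)) = x j ^ μ * p.eval (x j) := by
    rw [hsum, Finset.mul_sum]
    exact Finset.sum_congr rfl fun b _ => by rw [pow_add]; ring
  rw [rampValue, h₂, hev, mul_div_cancel₀ _ (pow_ne_zero _ (hx0 j)), add_neg_cancel]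

end Ramp

/-! ### Share sizes, divisibility and existence of the choices -/

section Sizes

variable {k n m : ℕ}

theorem dvd_of_eq_lcm (hm : m = (Finset.Icc 1 (n - k + 1)).lcm id) {a : ℕ} (h₁ : 1 ≤ a)
    (h₂ : a ≤ n - k + 1) : a ∣ m :=
  hm ▸ Finset.dvd_lcm (f := id) (Finset.mem_Icc.2 ⟨h₁, h₂⟩)

theorem pos_of_eq_lcm (hm : m = (Finset.Icc 1 (n - k + 1)).lcm id) : 0 < m := by
  rw [hm, Nat.pos_iff_ne_zero, Ne, Finset.lcm_eq_zero_iff]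
  simp

/-- With `n - k + 1 - i = a + 2`, the next layer adds `m / ((a + 1) * (a + 2))`, and `m / (a + 2) +
m / ((a + 1) * (a + 2)) = m / (a + 1)`. The divisions are exact because `a + 1` and `a + 2` are
coprime divisors of `m`. -/
theorem sum_layerShareSize (hm : m = (Finset.Icc 1 (n - k + 1)).lcm id) (i : ℕ)
    (hi : i ≤ n - k) :
    ∑ l : Fin (i + 1), layerShareSize k n m l = m / (n - k + 1 - i) := by
  induction i with
  | zero => rw [Fin.sum_univ_one, Fin.val_zero, layerShareSize]; simp
  | succ i ih =>
    rw [Fin.sum_univ_castSucc, Fin.val_last]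
    simp only [Fin.val_castSucc]
    rw [ih (by omega), layerShareSize, if_neg (by omega), ih (by omega)]
    obtain ⟨a, ha⟩ : ∃ a, n - k + 1 - (i + 1) = a + 1 := ⟨n - k + 1 - (i + 1) - 1, by omega⟩
    have ha' : n - k + 1 - i = a + 2 := by omega
    obtain ⟨u, hu⟩ := dvd_of_eq_lcm (a := a + 1) hm (by omega) (by omega)
    obtain ⟨v, hv⟩ := dvd_of_eq_lcm (a := a + 2) hm (by omega) (by omega)
    rw [ha, ha']
    have e₁ : m / (a + 2) = v := by rw [hv]; exact Nat.mul_div_cancel_left _ (by omega)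
    have e₂ : m / (a + 1) = u := by rw [hu]; exact Nat.mul_div_cancel_left _ (by omega)
    obtain ⟨w, rfl⟩ : a + 1 ∣ v := by
      refine (Nat.Coprime.dvd_of_dvd_mul_left (m := a + 2) ?_ ⟨u, hv.symm.trans hu⟩)
      exact (Nat.coprime_self_add_right (m := a + 1) (n := 1)).2 (by simp)
    rw [e₁, e₂, Nat.mul_div_cancel_left _ (Nat.succ_pos a)]
    refine Nat.eq_of_mul_eq_mul_left (Nat.succ_pos a) ?_
    rw [Nat.succ_eq_add_one, ← hu, hv]
    ring

/-- The truncating division in `layerShareSize` is exact, so every layer input splits into full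
blocks. -/
theorem layerShareSize_mul (hm : m = (Finset.Icc 1 (n - k + 1)).lcm id) (i : ℕ)
    (hi : i ≤ n - k) :
    layerShareSize k n m i * (n - k + 1 - i) =
      if i = 0 then m else ∑ l : Fin i, layerShareSize k n m l := by
  rcases i with - | i
  · rw [layerShareSize]
    simp only [if_true]
    exact Nat.div_mul_cancel (dvd_of_eq_lcm hm (by omega) (by omega))
  · have h := sum_layerShareSize hm (i + 1) hi
    rw [Fin.sum_univ_castSucc, Fin.val_last] at h
    simp only [Fin.val_castSucc] at h
    rw [sum_layerShareSize hm i (by omega)] at h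
    rw [if_neg (by omega), sum_layerShareSize hm i (by omega)]
    have d₁ := Nat.div_mul_cancel (dvd_of_eq_lcm (a := n - k + 1 - (i + 1)) hm
      (by omega) (by omega))
    have d₂ := Nat.div_mul_cancel (dvd_of_eq_lcm (a := n - k + 1 - i) hm (by omega) (by omega))
    rw [← h] at d₁
    have e : n - k + 1 - i = n - k + 1 - (i + 1) + 1 := by omega
    rw [e] at d₁ d₂ ⊢
    rw [e] at h
    linarith

end Sizes

/-- Layer `i > 0` receives exactly one share from each earlier layer `l`, namely the one with
zero-based number `i - l - 1`. -/
theorem card_layerInput {k n m : ℕ} (i : Fin (n - k + 1)) :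
    Fintype.card (LayerInput k n m i) =
      if (i : ℕ) = 0 then m else ∑ l : Fin i, layerShareSize k n m l := by
  split_ifs with hi
  · refine (Fintype.card_congr (β := Fin m) ?_).trans (Fintype.card_fin m)
    refine
      { toFun := fun w => match w with
          | ⟨Sum.inl a, _⟩ => a
          | ⟨Sum.inr w, h⟩ => absurd h (by simp only [targetLayer]; omega)
        invFun := fun a => ⟨Sum.inl a, by simp [targetLayer, hi]⟩
        left_inv := ?_
        right_inv := fun a => rfl }
    rintro ⟨a | w, h⟩
    · rfl
    · exact absurd h (by simp only [targetLayer]; omega)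
  · have : ∑ l : Fin i, layerShareSize k n m l =
        Fintype.card (Σ l : Fin i, Fin (layerShareSize k n m l)) := by simp
    rw [this]
    refine Fintype.card_congr
      { toFun := fun w => match w with
          | ⟨Sum.inl a, h⟩ => absurd h (by simp only [targetLayer]; omega)
          | ⟨Sum.inr w, h⟩ => ⟨⟨w.1, by simp only [targetLayer] at h; omega⟩, w.2.2⟩
        invFun := fun a => ⟨Sum.inr ⟨⟨a.1, by omega⟩, ⟨i - a.1 - 1, by
          have := a.1.2; have := i.2; simp only; omega⟩, a.2⟩, by
            have := a.1.2; simp only [targetLayer]; omega⟩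
        left_inv := ?_
        right_inv := fun a => rfl }
    rintro ⟨a | ⟨l, t, c⟩, h⟩
    · exact absurd h (by simp only [targetLayer]; omega)
    · have : (i : ℕ) - l - 1 = t := by simp only [targetLayer] at h; omega
      simp only [this]

theorem nonempty_choices {k n m q : ℕ} [Fact q.Prime] (hkn : k ≤ n) (hnk : n ≤ 2 * k - 1)
    (hq : n + k - 1 < q) (hm : m = (Finset.Icc 1 (n - k + 1)).lcm id) :
    Nonempty (Choices q k n m) := by
  have hp : ∀ i : Fin (n - k + 1), Nonempty (RampShare k n i ↪ {x : ZMod q // x ≠ 0}) := by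
    intro i
    refine Function.Embedding.nonempty_of_card_le ?_
    have := i.2
    rw [Fintype.card_subtype_compl]
    simp only [Fintype.card_sum, Fintype.card_fin, ZMod.card, Fintype.card_unique]
    omega
  have hg : ∀ i : Fin (n - k + 1), Nonempty
      (LayerInput k n m i ≃ Fin (layerShareSize k n m i) × Fin (n - k + 1 - i)) := by
    intro i
    refine ⟨Fintype.equivOfCardEq ?_⟩
    rw [card_layerInput, Fintype.card_prod, Fintype.card_fin, Fintype.card_fin,
      layerShareSize_mul hm i (by omega)]
  exact ⟨{
    point := fun i j => (hp i).some j
    point_injective := fun i => Subtype.val_injective.comp (hp i).some.injective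
    point_ne_zero := fun i j => ((hp i).some j).2
    grouping := fun i => (hg i).some }⟩

/-! ### Share size and communication cost -/

section Cost

variable {q k n m : ℕ}

theorem card_partyQudit_filter (hm : m = (Finset.Icc 1 (n - k + 1)).lcm id)
    (D : Finset (Fin n)) (L : ℕ) (hL : L ≤ n - k) :
    (Finset.univ.filter fun w : PartyQudit k n m => w.2.1 ∈ D ∧ (w.1 : ℕ) < L + 1).card =
      D.card * (m / (n - k + 1 - L)) := by
  have h : (Finset.univ.filter fun w : PartyQudit k n m => w.2.1 ∈ D ∧ (w.1 : ℕ) < L + 1) =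
      (Finset.univ.filter fun i : Fin (n - k + 1) => (i : ℕ) < L + 1).sigma
        fun i => D ×ˢ (Finset.univ : Finset (Fin (layerShareSize k n m i))) := by
    ext w
    simp [and_comm]
  rw [h, Finset.card_sigma, ← sum_layerShareSize hm L hL]
  simp only [Finset.card_product, Finset.card_univ, Fintype.card_fin]
  rw [← Finset.mul_sum, Finset.sum_filter,
    Fin.sum_univ_eq_sum_range (fun i => if i < L + 1 then layerShareSize k n m i else 0),
    Fin.sum_univ_eq_sum_range (fun i => layerShareSize k n m i), ← Finset.sum_filter]
  congr 2
  ext a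
  simp only [Finset.mem_filter, Finset.mem_range]
  omega

variable [NeZero q] (P : Choices q k n m)

theorem shareSize_concatScheme (hm : m = (Finset.Icc 1 (n - k + 1)).lcm id) (j : Fin n) :
    (concatScheme P).shareSize j = m := by
  have h := card_partyQudit_filter hm {j} (n - k) le_rfl
  rw [Nat.add_sub_cancel_left, Nat.div_one, Finset.card_singleton, one_mul] at h
  refine Eq.trans (congrArg Finset.card (Finset.filter_congr fun w _ => ?_)) h
  exact ⟨fun hw => ⟨hw, w.1.2⟩, fun hw => hw.1⟩

theorem commCost_concatScheme (hm : m = (Finset.Icc 1 (n - k + 1)).lcm id) {d : ℕ}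
    (hd : k ≤ d) (hdn : d ≤ n) : (concatScheme P).commCost d = d * (m / (d - k + 1)) := by
  have key : ∀ D ∈ (Finset.univ : Finset (Fin n)).powersetCard d,
      ((concatScheme P).sent D).card = d * (m / (d - k + 1)) := by
    intro D hD
    have hD' := (Finset.mem_powersetCard.1 hD).2
    have h := card_partyQudit_filter hm D (n - d) (by omega)
    rw [show n - k + 1 - (n - d) = d - k + 1 by omega] at h
    rw [hD'] at h
    rw [← h]
    simp only [concatScheme, hD']
  rw [Scheme.commCost, Finset.sup_congr rfl key]
  exact Finset.sup_const (Finset.powersetCard_nonempty.2 (by simpa using hdn)) _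

theorem cast_commCost_concatScheme (hm : m = (Finset.Icc 1 (n - k + 1)).lcm id) {d : ℕ}
    (hd : k ≤ d) (hdn : d ≤ n) :
    ((concatScheme P).commCost d : ℚ) = (d : ℚ) * m / ((d : ℚ) - k + 1) := by
  have hpos : ((d - k + 1 : ℕ) : ℚ) ≠ 0 := by positivity
  rw [commCost_concatScheme P hm hd hdn, Nat.cast_mul,
    Nat.cast_div (dvd_of_eq_lcm hm (by omega) (by omega)) hpos, Nat.cast_add, Nat.cast_sub hd,
    Nat.cast_one, mul_div_assoc]

theorem commCost_concatScheme_lt (hm : m = (Finset.Icc 1 (n - k + 1)).lcm id) (hk : 1 < k)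
    {d d' : ℕ} (hd : k ≤ d) (hdd' : d < d') (hd' : d' ≤ n) :
    (concatScheme P).commCost d' < (concatScheme P).commCost d := by
  have hmpos : (0 : ℚ) < m := by exact_mod_cast pos_of_eq_lcm hm
  rw [← Nat.cast_lt (α := ℚ), cast_commCost_concatScheme P hm (hd.trans hdd'.le) hd',
    cast_commCost_concatScheme P hm hd (hdd'.le.trans hd')]
  have h₁ : (k : ℚ) ≤ d := by exact_mod_cast hd
  have h₂ : (d : ℚ) < d' := by exact_mod_cast hdd'
  have h₃ : (1 : ℚ) < k := by exact_mod_cast hk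
  rw [div_lt_div_iff₀ (by linarith) (by linarith)]
  -- The difference of the cross products is `m (d' - d) (k - 1)`; this is where `k > 1` makes the
  -- decrease strict.
  nlinarith [mul_pos hmpos (mul_pos (sub_pos.2 h₂) (sub_pos.2 h₃))]

end Cost

/-! ### Fixed points of recursions that respect a rank -/

section Layered

variable {I κ : Type} (rank : I → ℕ) (T : (I → κ) → I → κ)

/-- Under iteration from a constant, the value at `w` stabilizes after `rank w + 1` steps. Forwarded
labels are a fixed point of this kind, ranked by layer. -/
theorem exists_fixed_of_layered [Nonempty κ]
    (hT : ∀ f g w, (∀ w', rank w' < rank w → f w' = g w') → T f w = T g w) :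
    ∃ f, T f = f := by
  obtain ⟨c⟩ := ‹Nonempty κ›
  have key : ∀ N w, rank w < N → ∀ N', rank w < N' →
      T^[N] (fun _ => c) w = T^[N'] (fun _ => c) w := by
    intro N
    induction N with
    | zero => intro w h; omega
    | succ N ih =>
      intro w hw N' hN'
      obtain ⟨N', rfl⟩ : ∃ a, N' = a + 1 := ⟨N' - 1, by omega⟩
      rw [Function.iterate_succ_apply', Function.iterate_succ_apply']
      exact hT _ _ _ fun w' hw' => ih w' (by omega) N' (by omega)
  refine ⟨fun w => T^[rank w + 1] (fun _ => c) w, funext fun w => ?_⟩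
  rw [Function.iterate_succ_apply']
  exact hT _ _ _ fun w' hw' => key _ _ (by omega) _ hw'

theorem fixed_unique_of_layered
    (hT : ∀ f g w, (∀ w', rank w' < rank w → f w' = g w') → T f w = T g w)
    {f g : I → κ} (hf : T f = f) (hg : T g = g) : f = g := by
  have key : ∀ N w, rank w < N → f w = g w := by
    intro N
    induction N with
    | zero => intro w h; omega
    | succ N ih =>
      intro w hw
      rw [← hf, ← hg]
      exact hT _ _ _ fun w' hw' => ih w' (by omega)
  exact funext fun w => key _ w (Nat.lt_succ_self _)

end Layered

/-! ### Linear algebra of the layered encoding -/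

section Consistent

variable {q k n m : ℕ}

/-- The randomness used by all layers. -/
abbrev Randomness (q k n m : ℕ) : Type :=
  (i : Fin (n - k + 1)) → Fin (layerShareSize k n m i) → Fin (k - 1) → ZMod q

/-- The input of block `c` of layer `i`. -/
def blockInput (P : Choices q k n m) (s : Fin m → ZMod q) (f : ForwardQudit k n m → ZMod q)
    (i : Fin (n - k + 1)) (c : Fin (layerShareSize k n m i)) : Fin (n - k + 1 - i) → ZMod q :=
  fun a => layerInput P s f i (c, a)

/-- The labels `f`, `y`, `e` are the outputs of the layers on the secret `s` with randomness `R`. -/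
def Consistent (P : Choices q k n m) (s : Fin m → ZMod q) (f : ForwardQudit k n m → ZMod q)
    (R : Randomness q k n m) (y : PartyQudit k n m → ZMod q)
    (e : DiscardedQudit k n m → ZMod q) : Prop :=
  ∀ i c j, layerOutput y f e i (j, c) = rampValue (P.point i) (blockInput P s f i c) (R i c) j

variable {P : Choices q k n m} {s s' : Fin m → ZMod q} {f f' : ForwardQudit k n m → ZMod q}
  {R R' : Randomness q k n m} {y y' : PartyQudit k n m → ZMod q}
  {e e' : DiscardedQudit k n m → ZMod q}

theorem blockInput_congr {i : Fin (n - k + 1)} {c : Fin (layerShareSize k n m i)}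
    (h : ∀ w : ForwardQudit k n m, (w.1 : ℕ) < i → f w = f' w) :
    blockInput P s f i c = blockInput P s f' i c := by
  funext a
  simp only [blockInput, layerInput]
  obtain ⟨w | w, hw⟩ := (P.grouping i).symm (c, a)
  · rfl
  · exact h w (by simp only [targetLayer] at hw; omega)

theorem blockInput_sub (i : Fin (n - k + 1)) (c : Fin (layerShareSize k n m i)) :
    blockInput P (s - s') (f - f') i c = blockInput P s f i c - blockInput P s' f' i c := by
  funext a
  simp only [blockInput, layerInput, Pi.sub_apply]
  obtain ⟨w | w, hw⟩ := (P.grouping i).symm (c, a) <;> rfl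

theorem blockInput_eq_zero {i : Fin (n - k + 1)} (hi : i ≠ 0)
    (h : ∀ w : ForwardQudit k n m, (w.1 : ℕ) + w.2.1 + 1 = i → f w = 0)
    (c : Fin (layerShareSize k n m i)) : blockInput P s f i c = 0 := by
  funext a
  simp only [blockInput, layerInput]
  obtain ⟨w | w, hw⟩ := (P.grouping i).symm (c, a)
  · exact absurd (Fin.ext hw.symm) hi
  · exact h w hw

theorem sum_elim_eq_zero_of_blockInput {i : Fin (n - k + 1)}
    (h : ∀ c, blockInput P s f i c = 0) (w : Fin m ⊕ ForwardQudit k n m)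
    (hw : targetLayer w = (i : ℕ)) : Sum.elim s f w = 0 := by
  have := congr_fun (h (P.grouping i ⟨w, hw⟩).1) (P.grouping i ⟨w, hw⟩).2
  simpa [blockInput, layerInput] using this

theorem Consistent.sub (h : Consistent P s f R y e) (h' : Consistent P s' f' R' y' e') :
    Consistent P (s - s') (f - f') (R - R') (y - y') (e - e') := by
  intro i c j
  rw [blockInput_sub, Pi.sub_apply, Pi.sub_apply, rampValue_sub, ← h, ← h']
  rcases j with j | j | j <;> rfl

theorem exists_forward (ρ : (i : Fin (n - k + 1)) → Fin (layerShareSize k n m i) →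
    (Fin (n - k + 1 - i) → ZMod q) → Fin (k - 1) → ZMod q) (P : Choices q k n m)
    (s : Fin m → ZMod q) :
    ∃ f, Consistent P s f (fun i c => ρ i c (blockInput P s f i c))
      (fun w => rampValue (P.point w.1) (blockInput P s f w.1 w.2.2)
        (ρ w.1 w.2.2 (blockInput P s f w.1 w.2.2)) (Sum.inl w.2.1))
      (fun w => rampValue (P.point w.1) (blockInput P s f w.1 w.2.2)
        (ρ w.1 w.2.2 (blockInput P s f w.1 w.2.2)) (Sum.inr (Sum.inr w.2.1))) := by
  obtain ⟨f, hf⟩ := exists_fixed_of_layered (I := ForwardQudit k n m) (fun w => (w.1 : ℕ))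
    (fun f w => rampValue (P.point w.1) (blockInput P s f w.1 w.2.2)
        (ρ w.1 w.2.2 (blockInput P s f w.1 w.2.2)) (Sum.inr (Sum.inl w.2.1)))
    (fun f g w h => by rw [blockInput_congr h])
  refine ⟨f, fun i c j => ?_⟩
  rcases j with j | j | j
  · rfl
  · exact (congr_fun hf ⟨i, j, c⟩).symm
  · rfl

theorem Consistent.unique (h : Consistent P s f R y e) (h' : Consistent P s f' R y' e') :
    f = f' ∧ y = y' ∧ e = e' := by
  have hf : f = f' := by
    refine fixed_unique_of_layered (I := ForwardQudit k n m) (fun w => (w.1 : ℕ))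
      (fun f w => rampValue (P.point w.1) (blockInput P s f w.1 w.2.2)
        (R w.1 w.2.2) (Sum.inr (Sum.inl w.2.1)))
      (fun f g w h => by rw [blockInput_congr h]) ?_ ?_
    · exact funext fun w => (h w.1 w.2.2 _).symm
    · exact funext fun w => (h' w.1 w.2.2 _).symm
  subst hf
  refine ⟨rfl, funext fun w => ?_, funext fun w => ?_⟩
  · exact (h w.1 w.2.2 (Sum.inl w.2.1)).trans (h' w.1 w.2.2 (Sum.inl w.2.1)).symm
  · exact (h w.1 w.2.2 (Sum.inr (Sum.inr w.2.1))).trans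
      (h' w.1 w.2.2 (Sum.inr (Sum.inr w.2.1))).symm

/-- Layer `i` has `n - i` unknowns per block. Zeros come from at least `n - i₀` shares in `D` and
from the `i₀ - i` shares forwarded to layers `i + 1, …, i₀`, whose inputs are already known to
vanish. -/
theorem Consistent.eq_zero [Fact q.Prime] (h : Consistent P s f R y e)
    (D : Finset (Fin n ⊕ Fin (2 * k - 1 - n))) (i₀ : ℕ) (hk : 0 < k) (hkn : k ≤ n)
    (hi₀ : i₀ ≤ n - k) (hD : n - i₀ ≤ D.card)
    (hy : ∀ w : PartyQudit k n m, Sum.inl w.2.1 ∈ D → (w.1 : ℕ) ≤ i₀ → y w = 0)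
    (he : ∀ w : DiscardedQudit k n m, Sum.inr w.2.1 ∈ D → (w.1 : ℕ) ≤ i₀ → e w = 0)
    (i : Fin (n - k + 1)) (hi : (i : ℕ) ≤ i₀) (c : Fin (layerShareSize k n m i)) :
    blockInput P s f i c = 0 ∧ R i c = 0 := by
  classical
  -- Downward induction on the layer, starting at `i₀`.
  have key : ∀ N, ∀ i : Fin (n - k + 1), (i : ℕ) ≤ i₀ → i₀ < N + i →
      ∀ c, blockInput P s f i c = 0 ∧ R i c = 0 := by
    intro N
    induction N with
    | zero => intro i _ _; omega
    | succ N ih =>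
      intro i hi hN c
      let Z : Finset (RampShare k n i) :=
        D.map ⟨Sum.map id Sum.inr, Function.Injective.sumMap Function.injective_id
          Sum.inr_injective⟩ ∪
        (Finset.univ.filter fun l : Fin (n - k - i) => (l : ℕ) < i₀ - i).map
          ⟨fun l => Sum.inr (Sum.inl l), Sum.inr_injective.comp Sum.inl_injective⟩
      refine eq_zero_of_rampValue_eq_zero (P.point_injective i) Z ?_ ?_
      · rw [Finset.card_union_of_disjoint, Finset.card_map, Finset.card_map,
          Fin.card_filter_val_lt]
        · have := i.2
          omega
        · rw [Finset.disjoint_left]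
          intro j hj hj'
          simp only [Finset.mem_map, Function.Embedding.coeFn_mk] at hj hj'
          obtain ⟨l, -, rfl⟩ := hj'
          obtain ⟨a | a, -, ha⟩ := hj <;> simp at ha
      · intro j hj
        rw [← h]
        simp only [Z, Finset.mem_union, Finset.mem_map, Function.Embedding.coeFn_mk,
          Finset.mem_filter] at hj
        rcases hj with ⟨a | a, ha, rfl⟩ | ⟨l, ⟨-, hl⟩, rfl⟩
        · exact hy ⟨i, a, c⟩ ha hi
        · exact he ⟨i, a, c⟩ ha hi
        · have hlt : (i : ℕ) + l + 1 < n - k + 1 := by omega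
          exact sum_elim_eq_zero_of_blockInput (i := ⟨i + l + 1, hlt⟩)
            (fun c => (ih ⟨i + l + 1, hlt⟩ (by simp only; omega)
              (by simp only; omega) c).1)
            (Sum.inr ⟨i, l, c⟩) rfl
  exact key (i₀ + 1) i hi (by omega) c

/-- In layer `i ≤ i₀`, the shares outside `D` and those forwarded beyond layer `i₀` number at most
`(2k - 1 - n + i₀) + (n - k - i₀) = k - 1`, so randomness can cancel them. Later layers then have
zero input and take zero randomness. -/
theorem exists_consistent_eq_zero [Fact q.Prime] (P : Choices q k n m)
    (D : Finset (Fin n ⊕ Fin (2 * k - 1 - n))) (i₀ : ℕ) (hkn : k ≤ n) (hnk : n ≤ 2 * k - 1)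
    (hi₀ : i₀ ≤ n - k) (hD : n - i₀ ≤ D.card) (s : Fin m → ZMod q) :
    ∃ f R y e, Consistent P s f R y e ∧
      (∀ w : PartyQudit k n m, (Sum.inl w.2.1 ∈ D → i₀ < (w.1 : ℕ)) → y w = 0) ∧
      ∀ w : DiscardedQudit k n m, (Sum.inr w.2.1 ∈ D → i₀ < (w.1 : ℕ)) → e w = 0 := by
  classical
  let Z : (i : Fin (n - k + 1)) → Finset (RampShare k n i) := fun i =>
    Dᶜ.map ⟨Sum.map id Sum.inr, Function.Injective.sumMap Function.injective_id
      Sum.inr_injective⟩ ∪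
    (Finset.univ.filter fun l : Fin (n - k - i) => ¬ (l : ℕ) < i₀ - i).map
      ⟨fun l => Sum.inr (Sum.inl l), Sum.inr_injective.comp Sum.inl_injective⟩
  have hZ : ∀ i : Fin (n - k + 1), (i : ℕ) ≤ i₀ → (Z i).card ≤ k - 1 := by
    intro i hi
    refine (Finset.card_union_le _ _).trans ?_
    have h₁ := Finset.card_filter_add_card_filter_not (s := Finset.univ)
      fun l : Fin (n - k - i) => (l : ℕ) < i₀ - i
    rw [Fin.card_filter_val_lt, Finset.card_univ, Fintype.card_fin] at h₁
    have h₂ := D.card_add_card_compl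
    rw [Fintype.card_sum, Fintype.card_fin, Fintype.card_fin] at h₂
    rw [Finset.card_map, Finset.card_map]
    omega
  have hex : ∀ (i : Fin (n - k + 1)) (a : Fin (n - k + 1 - i) → ZMod q),
      ∃ r : Fin (k - 1) → ZMod q,
        ((i : ℕ) ≤ i₀ → ∀ j ∈ Z i, rampValue (P.point i) a r j = 0) ∧ (i₀ < i → r = 0) := by
    intro i a
    by_cases hi : (i : ℕ) ≤ i₀
    · obtain ⟨r, hr⟩ := exists_rampValue_eq_zero (P.point_injective i) (P.point_ne_zero i) (Z i)
        (hZ i hi) a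
      exact ⟨r, fun _ => hr, fun h => absurd hi (by omega)⟩
    · exact ⟨0, fun h => absurd h hi, fun _ => rfl⟩
  choose r hr₁ hr₂ using hex
  obtain ⟨f, hf⟩ := exists_forward (fun i _ a => r i a) P s
  have key : ∀ N, ∀ i : Fin (n - k + 1), i₀ < i → (i : ℕ) < N → ∀ c, blockInput P s f i c = 0 := by
    intro N
    induction N with
    | zero => intro i _ h; omega
    | succ N ih =>
      intro i hi hN
      refine blockInput_eq_zero (by rintro rfl; simp at hi) fun w hw => ?_
      refine (hf w.1 w.2.2 (Sum.inr (Sum.inl w.2.1))).trans ?_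
      by_cases hw' : (w.1 : ℕ) ≤ i₀
      · refine hr₁ _ _ hw' _ ?_
        simp only [Z, Finset.mem_union, Finset.mem_map, Function.Embedding.coeFn_mk,
          Finset.mem_filter]
        exact Or.inr ⟨w.2.1, ⟨Finset.mem_univ _, by omega⟩, rfl⟩
      · beta_reduce
        rw [hr₂ _ _ (by omega), ih w.1 (by omega) (by omega), rampValue_zero]
  have hout : ∀ (i : Fin (n - k + 1)) c (j : Fin n ⊕ Fin (2 * k - 1 - n)),
      (j ∈ D → i₀ < (i : ℕ)) → rampValue (P.point i) (blockInput P s f i c)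
        (r i (blockInput P s f i c)) (Sum.map id Sum.inr j) = 0 := by
    intro i c j hj
    by_cases hi : (i : ℕ) ≤ i₀
    · refine hr₁ _ _ hi _ ?_
      simp only [Z, Finset.mem_union, Finset.mem_map, Function.Embedding.coeFn_mk]
      exact Or.inl ⟨j, Finset.mem_compl.2 fun h => absurd (hj h) (by omega), rfl⟩
    · rw [hr₂ _ _ (by omega), key _ i (by omega) (Nat.lt_succ_self _), rampValue_zero]
  exact ⟨f, _, _, _, hf, fun w hw => hout w.1 w.2.2 (Sum.inl w.2.1) hw,
    fun w hw => hout w.1 w.2.2 (Sum.inr w.2.1) hw⟩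

end Consistent

/-! ### Lost qudits as part of the environment -/

section ReducedState

variable {q : ℕ} {Q ε σ : Type} [DecidableEq Q]

/-- Split off the qudits outside `A` and regard them as part of the environment. -/
def splitEquiv (q : ℕ) (ε : Type) (A : Finset Q) :
    ({w // w ∈ A} → ZMod q) × (({w // ¬ w ∈ A} → ZMod q) × ε) ≃ (Q → ZMod q) × ε :=
  (Equiv.prodAssoc _ _ _).symm.trans
    ((Equiv.piEquivPiSubtypeProd (fun w => w ∈ A) fun _ => ZMod q).symm.prodCongr (Equiv.refl ε))

theorem reducedState_traceOutRight_conj [NeZero q] [Fintype Q] [Fintype ε] [Fintype σ]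
    (A : Finset Q) (M : Matrix ((Q → ZMod q) × ε) σ ℂ)
    (ρ : Matrix σ σ ℂ) :
    reducedState A (traceOutRight (M * ρ * Mᴴ)) =
      traceOutRight (M.submatrix (splitEquiv q ε A) id * ρ *
        (M.submatrix (splitEquiv q ε A) id)ᴴ) := by
  ext a a'
  simp only [reducedState, traceOutRight, Matrix.submatrix_apply, Fintype.sum_prod_type]
  rfl

theorem submatrix_splitEquiv_isometry [NeZero q] [Fintype Q] [Fintype ε] [DecidableEq σ]
    (A : Finset Q) (M : Matrix ((Q → ZMod q) × ε) σ ℂ) (hM : Mᴴ * M = 1) :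
    (M.submatrix (splitEquiv q ε A) id)ᴴ * M.submatrix (splitEquiv q ε A) id = 1 := by
  rw [Matrix.conjTranspose_submatrix, Matrix.submatrix_mul_equiv, hM, Matrix.submatrix_id_id]

theorem splitEquiv_fst_of_mem (A : Finset Q) (a : {w // w ∈ A} → ZMod q)
    (b : ({w // ¬ w ∈ A} → ZMod q) × ε) {w : Q} (hw : w ∈ A) :
    (splitEquiv q ε A (a, b)).1 w = a ⟨w, hw⟩ := by
  simp [splitEquiv, Equiv.piEquivPiSubtypeProd, hw]

theorem splitEquiv_fst_of_notMem (A : Finset Q) (a : {w // w ∈ A} → ZMod q)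
    (b : ({w // ¬ w ∈ A} → ZMod q) × ε) {w : Q} (hw : w ∉ A) :
    (splitEquiv q ε A (a, b)).1 w = b.1 ⟨w, hw⟩ := by
  simp [splitEquiv, Equiv.piEquivPiSubtypeProd, hw]

theorem splitEquiv_snd (A : Finset Q) (a : {w // w ∈ A} → ZMod q)
    (b : ({w // ¬ w ∈ A} → ZMod q) × ε) : (splitEquiv q ε A (a, b)).2 = b.2 := rfl

end ReducedState

/-! ### Entries of the encoding matrix, recovery and secrecy -/

section ConcatMatrix

variable {q k n m : ℕ} [Fact q.Prime]

/-- The absolute value of the non-zero entries of `concatMatrix`. -/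
noncomputable def concatNorm (q k n m : ℕ) : ℝ :=
  ∏ i : Fin (n - k + 1), ∏ _c : Fin (layerShareSize k n m i), (Real.sqrt ((q : ℝ) ^ (k - 1)))⁻¹

open Classical in
theorem concatMatrix_apply (P : Choices q k n m)
    (ye : (PartyQudit k n m → ZMod q) × (DiscardedQudit k n m → ZMod q)) (s : Fin m → ZMod q) :
    concatMatrix P ye s = ∑ f, ∑ R, if Consistent P s f R ye.1 ye.2 then
      (concatNorm q k n m : ℂ) else 0 := by
  simp only [concatMatrix, blockRampEncoder, rampEncoder]
  refine Finset.sum_congr rfl fun f _ => ?_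
  simp only [Fintype.prod_sum]
  refine Finset.sum_congr rfl fun R _ => ?_
  simp only [Fintype.prod_ite_zero]
  split_ifs with h
  · simp only [concatNorm, Complex.ofReal_prod]
    exact Finset.prod_congr rfl fun i _ => if_pos fun c => funext fun j => h i c j
  · obtain ⟨i, hi⟩ := not_forall.1 h
    exact Finset.prod_eq_zero (Finset.mem_univ i)
      (if_neg fun h' => hi fun c j => congr_fun (h' c) j)

theorem Consistent.eq_of_eq (hk : 0 < k) (hkn : k ≤ n) {P : Choices q k n m}
    {s s' : Fin m → ZMod q} {f f' : ForwardQudit k n m → ZMod q}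
    {R R' : Randomness q k n m} {y y' : PartyQudit k n m → ZMod q}
    {e e' : DiscardedQudit k n m → ZMod q}
    (h : Consistent P s f R y e) (h' : Consistent P s' f' R' y' e')
    (D : Finset (Fin n ⊕ Fin (2 * k - 1 - n))) (i₀ : ℕ) (hi₀ : i₀ ≤ n - k) (hD : n - i₀ ≤ D.card)
    (hy : ∀ w : PartyQudit k n m, Sum.inl w.2.1 ∈ D → (w.1 : ℕ) ≤ i₀ → y w = y' w)
    (he : ∀ w : DiscardedQudit k n m, Sum.inr w.2.1 ∈ D → (w.1 : ℕ) ≤ i₀ → e w = e' w) :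
    s = s' := by
  have key := (h.sub h').eq_zero D i₀ hk hkn hi₀ hD
    (fun w h₁ h₂ => sub_eq_zero.2 (hy w h₁ h₂)) fun w h₁ h₂ => sub_eq_zero.2 (he w h₁ h₂)
  funext a
  exact sub_eq_zero.1 (sum_elim_eq_zero_of_blockInput (i := 0) (f := f - f') (s := s - s')
    (fun c => (key 0 (Nat.zero_le _) c).1) (Sum.inl a) rfl)

theorem Consistent.randomness_eq (hk : 0 < k) (hkn : k ≤ n)
    {P : Choices q k n m} {s : Fin m → ZMod q} {f f' : ForwardQudit k n m → ZMod q}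
    {R R' : Randomness q k n m} {y : PartyQudit k n m → ZMod q}
    {e : DiscardedQudit k n m → ZMod q}
    (h : Consistent P s f R y e) (h' : Consistent P s f' R' y e) : R = R' := by
  have key := (h.sub h').eq_zero Finset.univ (n - k) hk hkn le_rfl
    (by rw [Finset.card_univ, Fintype.card_sum, Fintype.card_fin, Fintype.card_fin]; omega)
    (fun w _ _ => sub_self _) fun w _ _ => sub_self _
  funext i c
  exact sub_eq_zero.1 (key i (by omega) c).2

/-- The label `ye` occurs in the encoding of `s`. -/
def IsOutput (P : Choices q k n m) (s : Fin m → ZMod q)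
    (ye : (PartyQudit k n m → ZMod q) × (DiscardedQudit k n m → ZMod q)) : Prop :=
  ∃ f R, Consistent P s f R ye.1 ye.2

theorem exists_consistent_of_concatMatrix_ne_zero {P : Choices q k n m}
    {ye : (PartyQudit k n m → ZMod q) × (DiscardedQudit k n m → ZMod q)} {s : Fin m → ZMod q}
    (h : concatMatrix P ye s ≠ 0) : ∃ f R, Consistent P s f R ye.1 ye.2 := by
  classical
  by_contra! h0
  refine h ?_
  rw [concatMatrix_apply]
  exact Finset.sum_eq_zero fun f _ => Finset.sum_eq_zero fun R _ => if_neg (h0 f R)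

theorem Consistent.concatMatrix_eq {P : Choices q k n m} {s : Fin m → ZMod q}
    {f : ForwardQudit k n m → ZMod q} {R : Randomness q k n m} {y : PartyQudit k n m → ZMod q}
    {e : DiscardedQudit k n m → ZMod q} (h : Consistent P s f R y e)
    (ye : (PartyQudit k n m → ZMod q) × (DiscardedQudit k n m → ZMod q)) :
    concatMatrix P ye s = concatMatrix P (ye.1 - y, ye.2 - e) 0 := by
  classical
  rw [concatMatrix_apply, concatMatrix_apply,
    ← Equiv.sum_comp (Equiv.subRight f) fun f' => ∑ R', if Consistent P 0 f' R' (ye.1 - y)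
      (ye.2 - e) then (concatNorm q k n m : ℂ) else 0]
  refine Finset.sum_congr rfl fun f' _ => ?_
  rw [← Equiv.sum_comp (Equiv.subRight R) fun R' => if Consistent P 0 (Equiv.subRight f f') R'
    (ye.1 - y) (ye.2 - e) then (concatNorm q k n m : ℂ) else 0]
  refine Finset.sum_congr rfl fun R' _ => if_congr ?_ rfl rfl
  refine ⟨fun h' => by simpa using h'.sub h, fun h' => ?_⟩
  -- Closure under addition is obtained from `Consistent.sub` as `h' - (0 - h)`.
  have h₀ : Consistent P 0 0 0 0 0 := by simpa using h.sub h
  have h₁ := h'.sub (h₀.sub h)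
  simpa using h₁

-- The secret and the full output determine `f` and `R`, so at most one term of the sum survives and
-- amplitudes never add up.
open Classical in
theorem concatMatrix_eq_ite (hk : 0 < k) (hkn : k ≤ n)
    (P : Choices q k n m)
    (ye : (PartyQudit k n m → ZMod q) × (DiscardedQudit k n m → ZMod q)) (s : Fin m → ZMod q) :
    concatMatrix P ye s = if IsOutput P s ye then (concatNorm q k n m : ℂ) else 0 := by
  split_ifs with h
  · obtain ⟨f, R, h⟩ := h
    rw [concatMatrix_apply, Finset.sum_eq_single f, Finset.sum_eq_single R, if_pos h]
    · exact fun R' _ hR => if_neg fun h' => hR (h'.randomness_eq hk hkn h)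
    · simp
    · refine fun f' _ hf => Finset.sum_eq_zero fun R' _ => if_neg fun h' => hf ?_
      obtain rfl := h'.randomness_eq hk hkn h
      exact (h'.unique h).1
    · simp
  · by_contra h0
    exact h (exists_consistent_of_concatMatrix_ne_zero h0)

theorem card_randomness_mul_concatNorm_sq :
    (Fintype.card (Randomness q k n m) : ℝ) * (concatNorm q k n m * concatNorm q k n m) = 1 := by
  have hq : (0 : ℝ) < (q : ℝ) ^ (k - 1) := pow_pos (by exact_mod_cast NeZero.pos q) _
  simp only [Fintype.card_pi, ZMod.card, Finset.prod_const, Finset.card_univ, Fintype.card_fin,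
    concatNorm]
  push_cast
  rw [← Finset.prod_mul_distrib, ← Finset.prod_mul_distrib]
  refine Finset.prod_eq_one fun i _ => ?_
  rw [← mul_pow, ← mul_pow, ← mul_inv, Real.mul_self_sqrt hq.le, mul_inv_cancel₀ hq.ne', one_pow]

open Classical in
theorem card_isOutput (hk : 0 < k) (hkn : k ≤ n) (P : Choices q k n m) (s : Fin m → ZMod q) :
    (Finset.univ.filter (IsOutput P s)).card = Fintype.card (Randomness q k n m) := by
  have hex : ∀ R : Randomness q k n m,
      ∃ ye : (PartyQudit k n m → ZMod q) × (DiscardedQudit k n m → ZMod q),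
        ∃ f, Consistent P s f R ye.1 ye.2 := fun R => by
    obtain ⟨f, hf⟩ := exists_forward (fun i c _ => R i c) P s
    exact ⟨(_, _), f, hf⟩
  choose Y F hY using hex
  rw [← Finset.card_univ]
  symm
  refine Finset.card_bij (fun R _ => Y R) (fun R _ => ?_) (fun R _ R' _ hR => ?_) fun ye hye => ?_
  · exact Finset.mem_filter.2 ⟨Finset.mem_univ _, F R, R, hY R⟩
  · have h := hY R
    rw [hR] at h
    exact h.randomness_eq hk hkn (hY R')
  · obtain ⟨-, f, R, h⟩ := Finset.mem_filter.1 hye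
    obtain ⟨-, h₁, h₂⟩ := (hY R).unique h
    exact ⟨R, Finset.mem_univ _, Prod.ext h₁ h₂⟩

/-- Columns have disjoint supports, since the full output determines the secret. Each support is in
bijection with the randomness, which gives norm one. -/
theorem concatMatrix_isometry (hk : 0 < k) (hkn : k ≤ n) (P : Choices q k n m) :
    (concatMatrix P)ᴴ * concatMatrix P = 1 := by
  classical
  ext s s'
  rw [Matrix.mul_apply]
  simp only [Matrix.conjTranspose_apply]
  rw [Matrix.one_apply]
  split_ifs with hs
  · subst hs
    have h : ∀ ye, star (concatMatrix P ye s) * concatMatrix P ye s =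
        if IsOutput P s ye then ((concatNorm q k n m * concatNorm q k n m : ℝ) : ℂ) else 0 := by
      intro ye
      rw [concatMatrix_eq_ite hk hkn]
      split_ifs <;> simp
    rw [Finset.sum_congr rfl fun ye _ => h ye, ← Finset.sum_filter, Finset.sum_const,
      card_isOutput hk hkn, nsmul_eq_mul]
    exact_mod_cast card_randomness_mul_concatNorm_sq
  · refine Finset.sum_eq_zero fun ye _ => ?_
    by_contra h0
    obtain ⟨f, R, h⟩ := exists_consistent_of_concatMatrix_ne_zero (P := P) (ye := ye) (s := s)
      fun h => h0 (by simp [h])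
    obtain ⟨f', R', h'⟩ := exists_consistent_of_concatMatrix_ne_zero (P := P) (ye := ye) (s := s')
      fun h => h0 (by simp [h])
    refine hs (h.eq_of_eq hk hkn h' Finset.univ (n - k) le_rfl ?_ (fun _ _ _ => rfl)
      fun _ _ _ => rfl)
    rw [Finset.card_univ, Fintype.card_sum, Fintype.card_fin, Fintype.card_fin]; omega

theorem mem_shares_concatScheme (P : Choices q k n m) (B : Finset (Fin n))
    (w : PartyQudit k n m) : w ∈ (concatScheme P).shares B ↔ w.2.1 ∈ B :=
  Finset.mem_filter.trans ⟨fun h => h.2, fun h => ⟨Finset.mem_univ _, h⟩⟩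

theorem mem_sent_concatScheme (P : Choices q k n m) (D : Finset (Fin n))
    (w : PartyQudit k n m) :
    w ∈ (concatScheme P).sent D ↔ w.2.1 ∈ D ∧ (w.1 : ℕ) < n - D.card + 1 :=
  Finset.mem_filter.trans ⟨fun h => h.2, fun h => ⟨Finset.mem_univ _, h⟩⟩

theorem recovers_concatScheme (hk : 0 < k) (hkn : k ≤ n) (hnk : n ≤ 2 * k - 1)
    (P : Choices q k n m) (D : Finset (Fin n)) (i₀ : ℕ) (hi₀ : i₀ ≤ n - k)
    (hD : n - i₀ ≤ D.card) (A : Finset (PartyQudit k n m))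
    (hA : ∀ w, w ∈ A ↔ w.2.1 ∈ D ∧ (w.1 : ℕ) ≤ i₀) : (concatScheme P).Recovers A := by
  have hD' : n - i₀ ≤ (D.map (Function.Embedding.inl (β := Fin (2 * k - 1 - n)))).card := by
    rwa [Finset.card_map]
  choose F R Y E hC hY hE using exists_consistent_eq_zero P
    (D.map (Function.Embedding.inl (β := Fin (2 * k - 1 - n)))) i₀ hkn hnk hi₀ hD'
  let M := (concatMatrix P).submatrix (splitEquiv q (DiscardedQudit k n m → ZMod q) A) id
  have hM : Mᴴ * M = 1 :=
    submatrix_splitEquiv_isometry A _ (concatMatrix_isometry hk hkn P)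
  have hsep : ∀ a b b' s s', M (a, b) s ≠ 0 → M (a, b') s' ≠ 0 → s = s' := by
    intro a b b' s s' h h'
    obtain ⟨f, R, h⟩ := exists_consistent_of_concatMatrix_ne_zero h
    obtain ⟨f', R', h'⟩ := exists_consistent_of_concatMatrix_ne_zero h'
    refine h.eq_of_eq hk hkn h' _ i₀ hi₀ hD' (fun w hw hwi => ?_) fun w hw => ?_
    · have hwA : w ∈ A := (hA w).2 ⟨by simpa using hw, hwi⟩
      rw [splitEquiv_fst_of_mem _ _ _ hwA, splitEquiv_fst_of_mem _ _ _ hwA]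
    · simp at hw
  let g : (Fin m → ZMod q) → {w // w ∈ A} → ZMod q := fun s w => Y s w
  have hshift : ∀ a b s, M (a, b) s = M (a - g s, b) 0 := by
    intro a b s
    refine ((hC s).concatMatrix_eq _).trans
      (congrArg (fun ye => concatMatrix P ye 0) (Prod.ext (funext fun w => ?_) ?_))
    · by_cases hw : w ∈ A
      · simp [splitEquiv_fst_of_mem _ _ _ hw, g]
      · simp only [Pi.sub_apply, splitEquiv_fst_of_notMem _ _ _ hw]
        rw [hY s w fun h => ?_, sub_zero]
        rw [hA] at hw
        by_contra hlt
        exact hw ⟨by simpa using h, not_lt.1 hlt⟩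
    -- `D` contains no discarded share, so the translation leaves the environment alone and acts on
    -- `A` only.
    · have : E s = 0 := funext fun w => hE s w (by simp)
      simp [splitEquiv_snd, this]
  obtain ⟨Φ, hΦ, hΦ'⟩ := exists_recovery M hM hsep 0 g hshift
  refine ⟨Φ, hΦ, fun ρ _ => ?_⟩
  exact (congrArg Φ (reducedState_traceOutRight_conj A (concatMatrix P) ρ)).trans (hΦ' ρ)

theorem noInformation_concatScheme (hk : 0 < k) (hkn : k ≤ n) (hnk : n ≤ 2 * k - 1)
    (P : Choices q k n m) (B : Finset (Fin n)) (hB : B.card < k) :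
    (concatScheme P).NoInformation ((concatScheme P).shares B) := by
  intro ρ ρ' hρ hρ'
  have hA := mem_shares_concatScheme P B
  generalize (concatScheme P).shares B = A at hA
  -- Outside `B` there are `2k - 1 - |B| ≥ k` parties and discarded shares, enough to decode with
  -- all layers.
  have hD : n - (n - k) ≤ ((B.map (Function.Embedding.inl (β := Fin (2 * k - 1 - n))))ᶜ).card := by
    rw [Finset.card_compl, Finset.card_map, Fintype.card_sum, Fintype.card_fin, Fintype.card_fin]
    omega
  choose F R Y E hC hY hE using exists_consistent_eq_zero P _ (n - k) hkn hnk le_rfl hD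
  let M := (concatMatrix P).submatrix (splitEquiv q (DiscardedQudit k n m → ZMod q) A) id
  have hsep : ∀ a a' b s s', M (a, b) s ≠ 0 → M (a', b) s' ≠ 0 → s = s' := by
    intro a a' b s s' h h'
    obtain ⟨f, R, h⟩ := exists_consistent_of_concatMatrix_ne_zero h
    obtain ⟨f', R', h'⟩ := exists_consistent_of_concatMatrix_ne_zero h'
    refine h.eq_of_eq hk hkn h' _ (n - k) le_rfl hD (fun w hw _ => ?_) fun w _ _ => rfl
    have hwA : w ∉ A := fun h => by simp [(hA w).1 h] at hw
    rw [splitEquiv_fst_of_notMem _ _ _ hwA, splitEquiv_fst_of_notMem _ _ _ hwA]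
  let g : (Fin m → ZMod q) →
      ({w // ¬ w ∈ A} → ZMod q) × (DiscardedQudit k n m → ZMod q) :=
    fun s => (fun w => Y s w, E s)
  have hshift : ∀ a b s, M (a, b) s = M (a, b - g s) 0 := by
    intro a b s
    refine ((hC s).concatMatrix_eq _).trans
      (congrArg (fun ye => concatMatrix P ye 0) (Prod.ext (funext fun w => ?_) rfl))
    by_cases hw : w ∈ A
    · simp only [Pi.sub_apply, splitEquiv_fst_of_mem _ _ _ hw]
      rw [hY s w fun h => ?_, sub_zero]
      simp [(hA w).1 hw] at h
    · simp [splitEquiv_fst_of_notMem _ _ _ hw, g]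
  simp only [concatScheme]
  rw [reducedState_traceOutRight_conj, reducedState_traceOutRight_conj]
  exact traceOutRight_conj_eq_of_trace_eq M hsep 0 g hshift (hρ.2.trans hρ'.2.symm)

end ConcatMatrix

end QSS

theorem mainTheorem5 (k n q : ℕ) [Fact q.Prime] (hk : 1 < k) (hkn : k ≤ n)
    (hnk : n ≤ 2 * k - 1) (hq : n + k - 1 < q) (m : ℕ)
    (hm : m = (Finset.Icc 1 (n - k + 1)).lcm id) :
    Nonempty (QSS.Choices q k n m) ∧
    ∀ P : QSS.Choices q k n m,
      (QSS.concatScheme P).IsUniversalCEQTS k ∧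
      (∀ j : Fin n, (QSS.concatScheme P).shareSize j = m) ∧
      ∀ d : ℕ, k ≤ d → d ≤ n →
        ((QSS.concatScheme P).commCost d : ℚ) = (d : ℚ) * m / ((d : ℚ) - k + 1) := by
  have hk0 : 0 < k := by omega
  refine ⟨QSS.nonempty_choices hkn hnk hq hm, fun P => ⟨⟨⟨hk, hkn, hnk,
    QSS.isQuantumChannel_traceOutRight_conj _ (QSS.concatMatrix_isometry hk0 hkn P),
    fun A hA => ?_, fun B hB => QSS.noInformation_concatScheme hk0 hkn hnk P B hB⟩,
    fun D hD => ⟨fun w hw => ?_, ?_⟩,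
    fun d d' hd hdd' hd' => QSS.commCost_concatScheme_lt P hm hk hd hdd' hd'⟩,
    QSS.shareSize_concatScheme P hm, fun d hd hdn => QSS.cast_commCost_concatScheme P hm hd hdn⟩⟩
  -- Full shares mean all layers, `i₀ = n - k`, for which `k` parties suffice.
  · refine QSS.recovers_concatScheme hk0 hkn hnk P A (n - k) le_rfl (by omega) _ fun w => ?_
    rw [QSS.mem_shares_concatScheme]
    exact ⟨fun h => ⟨h, Nat.lt_succ_iff.1 w.1.2⟩, fun h => h.1⟩
  · exact (QSS.mem_shares_concatScheme P D w).2 ((QSS.mem_sent_concatScheme P D w).1 hw).1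
  · have hDn : D.card ≤ n := by simpa using D.card_le_univ
    refine QSS.recovers_concatScheme hk0 hkn hnk P D (n - D.card) (by omega) (by omega) _
      fun w => ?_
    rw [QSS.mem_sent_concatScheme, Nat.lt_succ_iff]
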